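/- \textbf{Theorem.} Let $\mathbb{K}$ be a field, let $d\ge 2$ be an integer and let $R=\mathbb{K}[x_0,x_1,x_2]$ with its standard grading. Let $I=(f_0,f_1,f_2)\subset R$, where $f_0,f_1,f_2$ are homogeneous of degree $d$, and suppose that $\dim(R/I)=1$ and that $I$ is saturated with respect to $(x_0,x_1,x_2)$. Suppose that there are homogeneous polynomials $p_0,p_1,p_2\in R$ of degree $d-1$ such that, with $$\varphi=\begin{pmatrix} x_0 & p_0\\ -x_1 & p_1\\ 0 & p_2\end{pmatrix},$$ the sequence $$0\longrightarrow R(-d-1)\oplus R(-2d+1)\xrightarrow{\ \varphi\ }R(-d)^3\xrightarrow{\ (f_0,f_1,f_2)\ } I\longrightarrow 0$$ is exact. Let $\mathcal{A}=\mathbb{K}[x_0,x_1,x_2,y_0,y_1,y_2]$, bigraded by $\mathrm{bideg}(x_i)=(1,0)$ and $\mathrm{bideg}(y_j)=(0,1)$, and let $\mathcal{J}\subset\mathcal{A}$ be the ideal of defining equations of the Rees algebra of $I$, that is, the kernel of the $R$-algebra homomorphism $\mathcal{A}\to\mathcal{R}(I)=\bigoplus_{n\ge 0}I^nt^n\subset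 R[t]$, $y_j\mapsto f_jt$. Put $g_1=x_0y_0-x_1y_1$ and $g_2=p_0y_0+p_1y_1+p_2y_2$. Define Sylvester forms iteratively as follows. Put $F_0=g_2$. As long as $F_i\in(x_0,x_1)$, write $F_i=a_ix_0+b_ix_1$ with $a_i,b_i\in\mathcal{A}$ bihomogeneous of the same bidegree, and put $$F_{i+1}=\det\begin{pmatrix} y_0 & -y_1\\ a_i & b_i\end{pmatrix}.$$ Stop at the first $m\ge 0$ with $F_m\notin(x_0,x_1)$. Then this procedure can be carried out until it stops, it never continues indefinitely, and for every choice of the $a_i,b_i$ the following holds: $m\le d-1$; the ideal $\mathcal{J}$ is minimally generated by $g_1,g_2,F_1,\ldots,F_m$ (these $m+2$ elements generate $\mathcal{J}$, and none of them lies in the ideal generated by the others); $g_1$ is bihomogeneous of bidegree $(1,1)$, and $F_i$ is bihomogeneous of bidegree $(d-1-i,i+1)$ for $0\le i\le m$. In particular $\mathcal{J}$ is minimally generated in the bidegrees $(1,1),(d-1,1),(d-2,2),\ldots,(d-1-m,m+1)$. -/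

import Mathlib

noncomputable section

namespace PlaneRees

open MvPolynomial

/-- The polynomial ring `R = K[x₀, x₁, x₂]`. -/
abbrev PolyR (K : Type*) [Field K] : Type _ := MvPolynomial (Fin 3) K

/-- The polynomial ring `A = K[x₀, x₁, x₂, y₀, y₁, y₂]`: the variable `xᵢ` is indexed by
`Sum.inl i` and the variable `yⱼ` by `Sum.inr j`. -/
abbrev PolyA (K : Type*) [Field K] : Type _ := MvPolynomial (Fin 3 ⊕ Fin 3) K

section

variable {K : Type*} [Field K]

/-- The variable `xᵢ` of `A`. -/
def x (i : Fin 3) : PolyA K := X (Sum.inl i)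

/-- The variable `yⱼ` of `A`. -/
def y (j : Fin 3) : PolyA K := X (Sum.inr j)

/-- The inclusion of `R` in `A`. -/
def inclR : PolyR K →ₐ[K] PolyA K := rename Sum.inl

/-- The weights of the variables: `bideg xᵢ = (1, 0)` and `bideg yⱼ = (0, 1)`. -/
def bidegWeight : Fin 3 ⊕ Fin 3 → ℕ × ℕ := Sum.elim (fun _ => (1, 0)) (fun _ => (0, 1))

/-- `F` is bihomogeneous of bidegree `e`. -/
def IsBihomogeneous (F : PolyA K) (e : ℕ × ℕ) : Prop :=
  IsWeightedHomogeneous bidegWeight F e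

/-- The irrelevant maximal ideal `(x₀, x₁, x₂)` of `R`. -/
def irrelevantIdeal (K : Type*) [Field K] : Ideal (PolyR K) :=
  Ideal.span (Set.range (X : Fin 3 → PolyR K))

/-- `I` is saturated with respect to the irrelevant ideal `𝔪`, that is `(I : 𝔪^∞) = I`. -/
def IsSaturated (I : Ideal (PolyR K)) : Prop :=
  ∀ r : PolyR K, (∃ n : ℕ, ∀ a ∈ irrelevantIdeal K ^ n, a * r ∈ I) → r ∈ I

/-- The ideal of `R` generated by `f₀, f₁, f₂`. -/
def idealOf (f : Fin 3 → PolyR K) : Ideal (PolyR K) := Ideal.span (Set.range f)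

lemma mem_idealOf (f : Fin 3 → PolyR K) (j : Fin 3) : f j ∈ idealOf f :=
  Ideal.subset_span ⟨j, rfl⟩

/-- The linear map `R³ → R`, `v ↦ ∑ vᵢ fᵢ`, whose image is the ideal `(f₀, f₁, f₂)`. -/
def generatorsMap (f : Fin 3 → PolyR K) : (Fin 3 → PolyR K) →ₗ[PolyR K] PolyR K :=
  Fintype.linearCombination (PolyR K) f

/-- The sequence `0 → R² → R³ → (f₀, f₁, f₂) → 0` with maps `φ` and `v ↦ ∑ vᵢ fᵢ` is exact.
(Exactness at `(f₀, f₁, f₂)` is automatic.) -/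
structure IsPresentation (φ : Matrix (Fin 3) (Fin 2) (PolyR K)) (f : Fin 3 → PolyR K) :
    Prop where
  injective : Function.Injective φ.mulVecLin
  exact : Function.Exact φ.mulVecLin (generatorsMap f)

/-- The matrix with columns `(x₀, -x₁, 0)` and `(p₀, p₁, p₂)`. -/
def presMatrix (p : Fin 3 → PolyR K) : Matrix (Fin 3) (Fin 2) (PolyR K) :=
  !![X 0, p 0; -X 1, p 1; 0, p 2]

/-- The `j`-th entry of the row vector `(y₀, y₁, y₂) · φ`; the indices `j = 0, 1` give the two
equations `g₁, g₂` of the symmetric algebra. -/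
def symEquation (φ : Matrix (Fin 3) (Fin 2) (PolyR K)) (j : Fin 2) : PolyA K :=
  ∑ i, y i * inclR (φ i j)

/-- The presentation `A → Rees(I)`, `xᵢ ↦ xᵢ`, `yⱼ ↦ fⱼ t`, of the Rees algebra
`⨁ Iⁿ tⁿ ⊆ R[t]` of `I = (f₀, f₁, f₂)`. -/
def reesMap (f : Fin 3 → PolyR K) : PolyA K →ₐ[K] reesAlgebra (idealOf f) :=
  aeval (Sum.elim (fun i => algebraMap (PolyR K) (reesAlgebra (idealOf f)) (X i))
    (fun j => ⟨Polynomial.monomial 1 (f j),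
      reesAlgebra.monomial_mem.2 (by simpa using mem_idealOf f j)⟩))

/-- The ideal of `A` of the defining equations of the Rees algebra of `(f₀, f₁, f₂)`. -/
def reesIdeal (f : Fin 3 → PolyR K) : Ideal (PolyA K) := RingHom.ker (reesMap f)

/-- One step of the iteration: `F = a x₀ + b x₁`, where `a` and `b` are bihomogeneous of the
same bidegree, and `F'` is the determinant with rows `(y₀, -y₁)` and `(a, b)`. -/
def IsSylvesterStep (F F' : PolyA K) : Prop :=
  ∃ (e : ℕ × ℕ) (a b : PolyA K), IsBihomogeneous a e ∧ IsBihomogeneous b e ∧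
    F = a * x 0 + b * x 1 ∧ F' = Matrix.det !![y 0, -y 1; a, b]

/-- `F₀ = g`, each `Fᵢ₊₁` is a Sylvester form obtained from `Fᵢ ∈ (x₀, x₁)`, and the iteration
stops at `m` because `Fₘ ∉ (x₀, x₁)`. -/
structure IsSylvesterRun (g : PolyA K) (m : ℕ) (F : Fin (m + 1) → PolyA K) : Prop where
  start : F 0 = g
  step : ∀ i : Fin m, IsSylvesterStep (F i.castSucc) (F i.succ)
  halts : F (Fin.last m) ∉ Ideal.span {(x 0 : PolyA K), x 1}

/-- The family `G` generates the ideal `J`, and no member of `G` can be left out. -/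
def IsMinimalGeneratingFamily {ι : Type*} (J : Ideal (PolyA K)) (G : ι → PolyA K) : Prop :=
  Ideal.span (Set.range G) = J ∧ ∀ i, G i ∉ Ideal.span (G '' {i}ᶜ)

end

end PlaneRees

end

/-! The syzygy `(x₀, -x₁, 0)` forces `f₀ = x₁h` and `f₁ = x₀h`, so the Rees map factors as `param`
(`y₀ ↦ x₁z`, `y₁ ↦ x₀z`, `y₂ ↦ w`) followed by `z ↦ ht`, `w ↦ f₂t`. The first map has kernel `(g₁)`
(`dvd_of_param_eq_zero`); the second has kernel generated by the prime `G = param g₂`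
(`param_symEquation_one_dvd`). Hence `a ∈ J` iff `G ∣ param a`.

Under `param` a Sylvester step is multiplication by `z`, so `param Fᵢ = zⁱG` whatever `aᵢ, bᵢ` are
chosen. Give `x₀, x₁` weight 1, `z` weight -1 and `x₂, w` weight 0: the image of `param` is spanned
by the monomials of weight at least 0. Stopping at `m` means that `G` has a monomial of weight at
most `m`. If `param a = G D`, then, as least weights add, `D` has only weights at least `-m`, and
each of its monomials is `zⁱ param c` with `i ≤ m`. This writes `a` through the `Fᵢ` modulo `g₁`
(`IsSylvesterRun.mem_span`). The iteration ends because the degree in `x` drops at each step.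

For minimality, apply `param` to a relation, cancel `G` and set `xᵢ = w = 0`: a polynomial in `z`
remains whose coefficients are the constant terms of the coefficients of the `Fᵢ`, so these vanish.
Sending `x₀, y₀` to `t` and the other variables to 0 then deals with `g₁`
(`constantCoeff_eq_zero_of_relation`). -/

namespace PlaneRees

open MvPolynomial

/-! ### Weights, elimination of a variable, and renaming in polynomial rings -/

section General

variable {K : Type*} [Field K] {σ τ : Type*}

/-- The polynomials all of whose monomials have weight at least `n`. -/
def WeightGE (w : σ → ℤ) (n : ℤ) (F : MvPolynomial σ K) : Prop :=
  ∀ u, coeff u F ≠ 0 → n ≤ Finsupp.weight w u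

lemma WeightGE.add {w : σ → ℤ} {n : ℤ} {F G : MvPolynomial σ K} (hF : WeightGE w n F)
    (hG : WeightGE w n G) : WeightGE w n (F + G) := by
  intro u hu
  rw [coeff_add] at hu
  by_cases h : coeff u F = 0
  · exact hG u (by simpa [h] using hu)
  · exact hF u h

lemma WeightGE.mul {w : σ → ℤ} {m n : ℤ} {F G : MvPolynomial σ K} (hF : WeightGE w m F)
    (hG : WeightGE w n G) : WeightGE w (m + n) (F * G) := by
  classical
  intro u hu
  rw [coeff_mul] at hu
  obtain ⟨v, hv, hne⟩ := Finset.exists_ne_zero_of_sum_ne_zero hu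
  rw [← Finset.HasAntidiagonal.mem_antidiagonal.1 hv, map_add]
  exact add_le_add (hF _ (left_ne_zero_of_mul hne)) (hG _ (right_ne_zero_of_mul hne))

lemma WeightGE.of_isWeightedHomogeneous {w : σ → ℤ} {m n : ℤ} {F : MvPolynomial σ K}
    (hF : IsWeightedHomogeneous w F n) (h : m ≤ n) : WeightGE w m F :=
  fun _ hu => h.trans (hF hu).ge

/-- The monomials of least weight of a product come from those of the factors. -/
lemma exists_coeff_mul_ne_zero {w : σ → ℤ} {a b : ℤ} {G D : MvPolynomial σ K}
    (hG : WeightGE w a G) (hD : WeightGE w b D)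
    (hGa : ∃ u, coeff u G ≠ 0 ∧ Finsupp.weight w u = a)
    (hDb : ∃ u, coeff u D ≠ 0 ∧ Finsupp.weight w u = b) :
    ∃ u, coeff u (G * D) ≠ 0 ∧ Finsupp.weight w u = a + b := by
  classical
  have hne : weightedHomogeneousComponent w a G * weightedHomogeneousComponent w b D ≠ 0 := by
    refine mul_ne_zero ?_ ?_
    · obtain ⟨u, hu, hw⟩ := hGa
      exact fun h => hu (by simpa [coeff_weightedHomogeneousComponent, hw] using congr(coeff u $h))
    · obtain ⟨u, hu, hw⟩ := hDb
      exact fun h => hu (by simpa [coeff_weightedHomogeneousComponent, hw] using congr(coeff u $h))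
  obtain ⟨u, hu⟩ := exists_coeff_ne_zero hne
  have hw := ((weightedHomogeneousComponent_isWeightedHomogeneous a G).mul
    (weightedHomogeneousComponent_isWeightedHomogeneous b D)) hu
  refine ⟨u, ?_, hw⟩
  convert hu using 1
  rw [coeff_mul, coeff_mul]
  refine Finset.sum_congr rfl fun v hv => ?_
  have hv' : Finsupp.weight w v.1 + Finsupp.weight w v.2 = a + b := by
    rw [← map_add, Finset.HasAntidiagonal.mem_antidiagonal.1 hv, hw]
  simp only [coeff_weightedHomogeneousComponent]
  by_cases h1 : coeff v.1 G = 0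
  · simp [h1]
  by_cases h2 : coeff v.2 D = 0
  · simp [h2]
  have h3 := hG _ h1
  have h4 := hD _ h2
  rw [if_pos (by omega), if_pos (by omega)]

lemma exists_coeff_ne_zero_min_weight (w : σ → ℤ) {F : MvPolynomial σ K} (hF : F ≠ 0) :
    ∃ u, coeff u F ≠ 0 ∧ WeightGE w (Finsupp.weight w u) F := by
  obtain ⟨u, hu, hmin⟩ := Finset.exists_min_image F.support (Finsupp.weight w)
    (support_nonempty.2 hF)
  exact ⟨u, mem_support_iff.1 hu, fun v hv => hmin v (mem_support_iff.2 hv)⟩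

/-- Least weights add in a product, since polynomials over a field form a domain. -/
lemma WeightGE.of_mul {w : σ → ℤ} {a c : ℤ} {G D : MvPolynomial σ K}
    (hGD : WeightGE w c (G * D)) (hG : ∃ u, coeff u G ≠ 0 ∧ Finsupp.weight w u ≤ a) :
    WeightGE w (c - a) D := by
  intro v hv
  obtain ⟨u, hu, hua⟩ := hG
  obtain ⟨u₀, hu₀, hmin⟩ := exists_coeff_ne_zero_min_weight w
    (show G ≠ 0 by rintro rfl; simp at hu)
  obtain ⟨v₀, hv₀, hmin'⟩ := exists_coeff_ne_zero_min_weight w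
    (show D ≠ 0 by rintro rfl; simp at hv)
  obtain ⟨s, hs, hsw⟩ := exists_coeff_mul_ne_zero hmin hmin' ⟨u₀, hu₀, rfl⟩ ⟨v₀, hv₀, rfl⟩
  have h1 := hGD s hs
  have h2 := hmin u hu
  have h3 := hmin' v hv
  omega

/-- The kernel of a map that kills a prime `h Xᵢ + f` and is injective on a subring containing
`h`, `f` and the other variables is generated by that prime. -/
lemma dvd_of_map_eq_zero {C T : Type*} [CommRing C] [Algebra K C] [CommRing T] [Algebra K T]
    (φ : MvPolynomial σ K →ₐ[K] T) (ι : C →ₐ[K] MvPolynomial σ K)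
    (hinj : Function.Injective (φ.comp ι)) (i : σ) (h f : C) (hh : h ≠ 0)
    (hg : Prime (ι h * X i + ι f)) (hφ : φ (ι h * X i + ι f) = 0)
    (hX : ∀ j, j ≠ i → ∃ c, ι c = X j) {a : MvPolynomial σ K} (ha : φ a = 0) :
    ι h * X i + ι f ∣ a := by
  set g := ι h * X i + ι f with hgdef
  -- Pseudo-division by `g`: its leading coefficient `ι h` need not be a unit, so a power of it is
  -- allowed on the left.
  have key : ∀ a : MvPolynomial σ K, ∃ (n : ℕ) (D : MvPolynomial σ K) (c : C),
      ι h ^ n * a = g * D + ι c := by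
    intro a
    induction a using MvPolynomial.induction_on with
    | C r => exact ⟨0, 0, algebraMap K C r, by simp [MvPolynomial.algebraMap_eq]⟩
    | add a b iha ihb =>
      obtain ⟨n, D, c, h1⟩ := iha
      obtain ⟨n', D', c', h2⟩ := ihb
      refine ⟨n + n', ι h ^ n' * D + ι h ^ n * D', h ^ n' * c + h ^ n * c', ?_⟩
      simp only [map_add, map_mul, map_pow]
      linear_combination ι h ^ n' * h1 + ι h ^ n * h2
    | mul_X a j iha =>
      obtain ⟨n, D, c, h1⟩ := iha
      by_cases hj : j = i
      · subst hj
        refine ⟨n + 1, ι h * X j * D + ι c, - f * c, ?_⟩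
        simp only [map_mul, map_neg, hgdef] at h1 ⊢
        linear_combination ι h * X j * h1
      · obtain ⟨e, he⟩ := hX j hj
        refine ⟨n, D * X j, c * e, ?_⟩
        rw [map_mul, he]
        linear_combination X j * h1
  have hndvd : ¬ g ∣ ι h := by
    rintro ⟨D, hD⟩
    refine hh (hinj ?_)
    rw [map_zero, AlgHom.comp_apply, hD, map_mul, hφ, zero_mul]
  obtain ⟨n, D, c, h1⟩ := key a
  have hc : c = 0 := by
    refine hinj ?_
    have := congr(φ $h1)
    rw [map_mul, ha, map_add, map_mul, hφ] at this
    simpa using this.symm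
  rw [hc, map_zero, add_zero] at h1
  exact (hg.dvd_or_dvd ⟨D, h1⟩).resolve_left fun h' => hndvd (hg.dvd_of_dvd_pow h')

/-- Degrees in each variable add, so a common divisor involves no new variables and comes from the
smaller ring. -/
lemma isRelPrime_rename {e : σ → τ} (he : Function.Injective e) {a b : MvPolynomial σ K}
    (h : IsRelPrime a b) (ha : a ≠ 0) :
    IsRelPrime (MvPolynomial.rename e a) (MvPolynomial.rename e b) := by
  classical
  intro D hDa hDb
  have hvars : (D.vars : Set τ) ⊆ Set.range e := by
    obtain ⟨E, hE⟩ := hDa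
    have hne : D * E ≠ 0 := by
      rw [← hE]
      exact fun h0 => ha (rename_injective e he (by simpa using h0))
    intro j hj
    have : j ∈ (MvPolynomial.rename e a).vars := by
      have hj' := mem_vars_iff_degreeOf_ne_zero.1 (Finset.mem_coe.1 hj)
      rw [mem_vars_iff_degreeOf_ne_zero, hE,
        degreeOf_mul_eq (left_ne_zero_of_mul hne) (right_ne_zero_of_mul hne)]
      omega
    obtain ⟨i, -, rfl⟩ := Finset.mem_image.1 (vars_rename e a this)
    exact ⟨i, rfl⟩
  obtain ⟨D', rfl⟩ := exists_rename_eq_of_vars_subset_range D e he hvars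
  refine IsUnit.map _ (h ?_ ?_)
  · simpa [killCompl_rename_app he] using map_dvd (killCompl he) hDa
  · simpa [killCompl_rename_app he] using map_dvd (killCompl he) hDb

lemma isWeightedHomogeneous_rename {M : Type*} [AddCommMonoid M] {e : σ → τ} {w : τ → M}
    {n : M} {F : MvPolynomial σ K} (hF : IsWeightedHomogeneous (w ∘ e) F n) :
    IsWeightedHomogeneous w (MvPolynomial.rename e F) n := by
  intro u hu
  obtain ⟨v, rfl, hv⟩ := coeff_rename_ne_zero e F u hu
  rw [← hF hv, Finsupp.weight_apply, Finsupp.weight_apply,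
    Finsupp.sum_mapDomain_index (by simp) (by intros; rw [add_smul])]
  rfl

end General

/-! ### The parametrization of `x₀y₀ = x₁y₁`: its kernel and its image -/

section

variable {K : Type*} [Field K]

/-- The polynomial ring `K[x₀, x₁, x₂, z, w]`. -/
abbrev PolyP (K : Type*) [Field K] : Type _ := MvPolynomial (Fin 3 ⊕ Fin 2) K

/-- The parametrization `y₀ ↦ x₁ z`, `y₁ ↦ x₀ z`, `y₂ ↦ w` of `x₀ y₀ = x₁ y₁`. -/
noncomputable def param : PolyA K →ₐ[K] PolyP K :=
  aeval (Sum.elim (fun i => X (Sum.inl i))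
    ![X (Sum.inl 1) * X (Sum.inr 0), X (Sum.inl 0) * X (Sum.inr 0), X (Sum.inr 1)])

@[simp] lemma param_x (i : Fin 3) : param (x i : PolyA K) = X (Sum.inl i) := by
  simp [param, x]

@[simp] lemma param_y_zero :
    param (y 0 : PolyA K) = X (Sum.inl 1) * X (Sum.inr 0) := by simp [param, y]

@[simp] lemma param_y_one :
    param (y 1 : PolyA K) = X (Sum.inl 0) * X (Sum.inr 0) := by simp [param, y]

@[simp] lemma param_y_two : param (y 2 : PolyA K) = X (Sum.inr 1) := by simp [param, y]

@[simp] lemma param_inclR (r : PolyR K) : param (inclR r) = rename Sum.inl r := by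
  have : (param.comp inclR : PolyR K →ₐ[K] PolyP K) = rename Sum.inl := by
    ext i
    simp [param, inclR]
  exact congr($this r)

lemma symEquation_presMatrix_zero (p : Fin 3 → PolyR K) :
    symEquation (presMatrix p) 0 = x 0 * y 0 + -(x 1 * y 1) := by
  simp [symEquation, presMatrix, Fin.sum_univ_three, inclR, x, y]
  ring

lemma symEquation_presMatrix_one (p : Fin 3 → PolyR K) :
    symEquation (presMatrix p) 1 =
      y 0 * inclR (p 0) + y 1 * inclR (p 1) + y 2 * inclR (p 2) := by
  simp [symEquation, presMatrix, Fin.sum_univ_three]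

lemma param_symEquation_zero (p : Fin 3 → PolyR K) :
    param (symEquation (presMatrix p) 0) = 0 := by
  simp only [symEquation_presMatrix_zero, map_add, map_mul, map_neg, param_x, param_y_zero,
    param_y_one]
  ring

/-- The image of the second equation of the symmetric algebra under `param`. -/
lemma param_symEquation_one (p : Fin 3 → PolyR K) :
    param (symEquation (presMatrix p) 1) =
      rename Sum.inl (p 2) * X (Sum.inr 1) +
        X (Sum.inr 0) * rename Sum.inl (X 1 * p 0 + X 0 * p 1) := by
  simp only [symEquation_presMatrix_one, map_add, map_mul, param_inclR, param_y_zero,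
    param_y_one, param_y_two, rename_X]
  ring

lemma X_isRelPrime_iff {σ : Type*} {i : σ} {F : MvPolynomial σ K} :
    IsRelPrime (X i) F ↔ ¬ X i ∣ F :=
  X_prime.irreducible.isRelPrime_iff_not_dvd

lemma irreducible_symEquation_zero :
    Irreducible (x 0 * y 0 + -(x 1 * y 1) : PolyA K) := by
  classical
  refine irreducible_mul_X_add _ _ _ (X_ne_zero _) (by simp [x]) ?_ ?_
  · intro h
    rw [vars_neg] at h
    simpa [x, y] using vars_mul _ _ h
  · rw [IsRelPrime.neg_right_iff, x, X_isRelPrime_iff, X_prime.dvd_mul]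
    simp [x, y, X_dvd_X]

/-- The inclusion of `K[x₀, x₁, x₂, y₁, y₂]` in `A`. -/
noncomputable def inclY : PolyP K →ₐ[K] PolyA K :=
  aeval (Sum.elim x ![y 1, y 2])

/-- Once `x₀` is inverted, `z ↦ z/x₀` gives a left inverse, because `y₁ ↦ x₀z`. -/
lemma param_inclY_injective :
    Function.Injective (param.comp inclY : PolyP K →ₐ[K] PolyP K) := by
  let L := FractionRing (PolyP K)
  let ψ : PolyP K →ₐ[K] L := aeval (Sum.elim (fun i => algebraMap (PolyP K) L (X (Sum.inl i)))
    ![algebraMap (PolyP K) L (X (Sum.inr 0)) / algebraMap (PolyP K) L (X (Sum.inl 0)),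
      algebraMap (PolyP K) L (X (Sum.inr 1))])
  have hne : algebraMap (PolyP K) L (X (Sum.inl 0) : PolyP K) ≠ 0 := by
    simp
  have h : ψ.comp (param.comp inclY) = IsScalarTower.toAlgHom K (PolyP K) L := by
    refine algHom_ext fun i => ?_
    rcases i with i | i
    · simp [inclY, ψ]
    · fin_cases i
      · simp [inclY, ψ]
        rw [mul_div_left_comm, div_self hne, mul_one]
      · simp [inclY, ψ]
  refine Function.Injective.of_comp (f := ψ) ?_
  have : Function.Injective (ψ.comp (param.comp inclY)) := by
    rw [h]
    exact IsFractionRing.injective (PolyP K) L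
  exact this

/-- The kernel of `param` is generated by `x₀ y₀ - x₁ y₁`. -/
lemma dvd_of_param_eq_zero (p : Fin 3 → PolyR K) {a : PolyA K} (ha : param a = 0) :
    symEquation (presMatrix p) 0 ∣ a := by
  have e0 : inclY (X (Sum.inl 0) : PolyP K) = x 0 := by simp [inclY]
  have e1 : inclY (-(X (Sum.inl 1) * X (Sum.inr 0)) : PolyP K) = -(x 1 * y 1) := by
    simp [inclY]
  have key := dvd_of_map_eq_zero (param (K := K)) inclY param_inclY_injective (Sum.inr 0)
    (X (Sum.inl 0)) (-(X (Sum.inl 1) * X (Sum.inr 0))) (X_ne_zero _)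
  rw [e0, e1] at key
  rw [symEquation_presMatrix_zero]
  refine key irreducible_symEquation_zero.prime ?_ ?_ ha
  · have := param_symEquation_zero p
    rwa [symEquation_presMatrix_zero] at this
  · rintro (j | j) hj
    · exact ⟨X (Sum.inl j), by simp [inclY, x]⟩
    · fin_cases j
      · exact absurd rfl hj
      · exact ⟨X (Sum.inr 0), by simp [inclY, y]⟩
      · exact ⟨X (Sum.inr 1), by simp [inclY, y]⟩

/-- The weights `1, 1, 0, -1, 0` of the variables `x₀, x₁, x₂, z, w`. -/
def paramWeight : Fin 3 ⊕ Fin 2 → ℤ := Sum.elim ![1, 1, 0] ![-1, 0]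

lemma weight_paramWeight (u : Fin 3 ⊕ Fin 2 →₀ ℕ) :
    Finsupp.weight paramWeight u = u (Sum.inl 0) + u (Sum.inl 1) - u (Sum.inr 0) := by
  rw [Finsupp.weight_apply, Finsupp.sum_fintype _ _ (by simp)]
  simp [paramWeight, Fin.sum_univ_three]
  ring

lemma weightGE_param (a : PolyA K) : WeightGE paramWeight 0 (param a) := by
  have hX : ∀ i n, n ≤ paramWeight i → WeightGE paramWeight n (X i : PolyP K) := fun i n h =>
    .of_isWeightedHomogeneous (isWeightedHomogeneous_X K paramWeight i) h
  induction a using MvPolynomial.induction_on with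
  | C r =>
    rw [← MvPolynomial.algebraMap_eq, AlgHom.commutes, MvPolynomial.algebraMap_eq]
    exact .of_isWeightedHomogeneous (isWeightedHomogeneous_C _ r) le_rfl
  | add a b ha hb => rw [map_add]; exact ha.add hb
  | mul_X a i ha =>
    rw [map_mul, ← add_zero (0 : ℤ)]
    refine ha.mul ?_
    rcases i with i | i
    · have : param (X (Sum.inl i) : PolyA K) = X (Sum.inl i) := param_x i
      rw [this]
      refine hX _ _ ?_
      fin_cases i <;> simp [paramWeight]
    · fin_cases i
      · refine (param_y_zero (K := K)).symm ▸ ?_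
        exact (hX (Sum.inl 1) 1 (by simp [paramWeight])).mul (hX (Sum.inr 0) (-1) (by simp [paramWeight]))
      · refine (param_y_one (K := K)).symm ▸ ?_
        exact (hX (Sum.inl 0) 1 (by simp [paramWeight])).mul (hX (Sum.inr 0) (-1) (by simp [paramWeight]))
      · refine (param_y_two (K := K)).symm ▸ ?_
        exact hX _ 0 (by simp [paramWeight])

lemma WeightGE.mem_submodule {σ : Type*} {w : σ → ℤ} {n : ℤ} {F : MvPolynomial σ K}
    (hF : WeightGE w n F) (S : Submodule K (MvPolynomial σ K))
    (hS : ∀ u r, n ≤ Finsupp.weight w u → monomial u r ∈ S) : F ∈ S := by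
  rw [F.as_sum]
  exact S.sum_mem fun u hu => hS u _ (hF u (mem_support_iff.1 hu))

/-- Each `z` is paired with an `x₁`, giving `y₀`, or with an `x₀`, giving `y₁`; the hypothesis
provides enough partners. -/
lemma exists_param_eq_prod {a b k : ℕ} (c l : ℕ) (h : k ≤ a + b) : ∃ F : PolyA K,
    param F = X (Sum.inl 0) ^ a * X (Sum.inl 1) ^ b * X (Sum.inl 2) ^ c *
      (X (Sum.inr 0) ^ k * X (Sum.inr 1) ^ l) := by
  obtain ⟨i, j, a', b', rfl, rfl, rfl⟩ :
      ∃ i j a' b', k = i + j ∧ a = j + a' ∧ b = i + b' :=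
    ⟨min k b, k - min k b, a - (k - min k b), b - min k b, by omega, by omega, by omega⟩
  refine ⟨y 0 ^ i * y 1 ^ j * x 0 ^ a' * x 1 ^ b' * x 2 ^ c * y 2 ^ l, ?_⟩
  simp only [map_mul, map_pow, param_x, param_y_zero, param_y_one, param_y_two]
  ring

lemma monomial_eq_prod (u : Fin 3 ⊕ Fin 2 →₀ ℕ) (r : K) :
    monomial u r = C r * (X (Sum.inl 0) ^ u (Sum.inl 0) * X (Sum.inl 1) ^ u (Sum.inl 1) *
      X (Sum.inl 2) ^ u (Sum.inl 2) *
      (X (Sum.inr 0) ^ u (Sum.inr 0) * X (Sum.inr 1) ^ u (Sum.inr 1))) := by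
  rw [monomial_eq, Finsupp.prod_fintype _ _ (by simp)]
  simp [Fin.prod_univ_three]

lemma param_C (r : K) : param (C r) = C r := by
  rw [← MvPolynomial.algebraMap_eq, AlgHom.commutes, MvPolynomial.algebraMap_eq]

/-- At most `m` factors `z` remain without a partner `x₀` or `x₁`; they form the power in front. -/
lemma exists_pow_mul_param_eq_monomial (m : ℕ) (u : Fin 3 ⊕ Fin 2 →₀ ℕ) (r : K)
    (h : -(m : ℤ) ≤ Finsupp.weight paramWeight u) : ∃ i ≤ m, ∃ F : PolyA K,
      X (Sum.inr 0) ^ i * param F = monomial u r := by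
  rw [weight_paramWeight] at h
  obtain ⟨i, k, hi, hk, hle⟩ : ∃ i k, i ≤ m ∧ u (Sum.inr 0) = i + k ∧
      k ≤ u (Sum.inl 0) + u (Sum.inl 1) :=
    ⟨u (Sum.inr 0) - (u (Sum.inl 0) + u (Sum.inl 1)),
      min (u (Sum.inr 0)) (u (Sum.inl 0) + u (Sum.inl 1)), by omega, by omega, by omega⟩
  obtain ⟨F, hF⟩ := exists_param_eq_prod (K := K) (u (Sum.inl 2)) (u (Sum.inr 1)) hle
  refine ⟨i, hi, C r * F, ?_⟩
  rw [monomial_eq_prod, map_mul, param_C, hF, hk]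
  ring

/-- In weight at least 1 an `x₀` or `x₁` is left over after the pairing and factors out. The
preimage is unique only modulo `g₁`, which itself lies in `(x₀, x₁)`. -/
lemma mem_span_of_weightGE_one (p : Fin 3 → PolyR K) {F : PolyA K}
    (hF : WeightGE paramWeight 1 (param F)) : F ∈ Ideal.span {(x 0 : PolyA K), x 1} := by
  have h0 : (x 0 : PolyA K) ∈ Ideal.span {(x 0 : PolyA K), x 1} :=
    Ideal.subset_span (by simp)
  have h1 : (x 1 : PolyA K) ∈ Ideal.span {(x 0 : PolyA K), x 1} :=
    Ideal.subset_span (by simp)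
  have := hF.mem_submodule (((Ideal.span {(x 0 : PolyA K), x 1}).restrictScalars K).map
    param.toLinearMap) fun u r hu => by
      rw [weight_paramWeight] at hu
      rw [monomial_eq_prod]
      rcases Nat.eq_zero_or_pos (u (Sum.inl 0)) with h | h
      · obtain ⟨b, hb⟩ : ∃ b, u (Sum.inl 1) = b + 1 := ⟨u (Sum.inl 1) - 1, by omega⟩
        obtain ⟨F, hF⟩ := exists_param_eq_prod (K := K) (u (Sum.inl 2)) (u (Sum.inr 1))
          (show u (Sum.inr 0) ≤ u (Sum.inl 0) + b by omega)
        refine ⟨C r * F * x 1, Ideal.mul_mem_left _ _ h1, ?_⟩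
        simp only [AlgHom.toLinearMap_apply, map_mul, param_C, hF, param_x, hb]
        ring
      · obtain ⟨b, hb⟩ : ∃ b, u (Sum.inl 0) = b + 1 := ⟨u (Sum.inl 0) - 1, by omega⟩
        obtain ⟨F, hF⟩ := exists_param_eq_prod (K := K) (u (Sum.inl 2)) (u (Sum.inr 1))
          (show u (Sum.inr 0) ≤ b + u (Sum.inl 1) by omega)
        refine ⟨C r * F * x 0, Ideal.mul_mem_left _ _ h0, ?_⟩
        simp only [AlgHom.toLinearMap_apply, map_mul, param_C, hF, param_x, hb]
        ring
  obtain ⟨F', hF', hFF'⟩ := this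
  obtain ⟨D, hD⟩ := dvd_of_param_eq_zero p (a := F - F') (by
    rw [map_sub, sub_eq_zero]; exact hFF'.symm)
  rw [symEquation_presMatrix_zero] at hD
  have : F = F' + (D * y 0 * x 0 - D * y 1 * x 1) := by linear_combination hD
  rw [this]
  exact add_mem hF' (sub_mem (Ideal.mul_mem_left _ _ h0) (Ideal.mul_mem_left _ _ h1))

end

/-! ### The factored Rees map, its kernel, and the syzygies of `f` -/

section

variable {K : Type*} [Field K]

/-- The homomorphism `z ↦ h t`, `w ↦ g t` over `R`. -/
noncomputable def toPolynomial (h g : PolyR K) : PolyP K →ₐ[K] Polynomial (PolyR K) :=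
  aeval (Sum.elim (fun i => Polynomial.C (X i))
    ![Polynomial.C h * Polynomial.X, Polynomial.C g * Polynomial.X])

lemma toPolynomial_rename (h g r : PolyR K) :
    toPolynomial h g (rename Sum.inl r) = Polynomial.C r := by
  have : (toPolynomial h g).comp (rename Sum.inl) =
      IsScalarTower.toAlgHom K (PolyR K) (Polynomial (PolyR K)) := by
    ext i : 1
    simp [toPolynomial]
  exact congr($this r)

lemma coe_reesMap {f : Fin 3 → PolyR K} {h : PolyR K} (h0 : f 0 = X 1 * h) (h1 : f 1 = X 0 * h)
    (a : PolyA K) :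
    (reesMap f a : Polynomial (PolyR K)) = toPolynomial h (f 2) (param a) := by
  have : ((reesAlgebra (idealOf f)).val.restrictScalars K).comp (reesMap f) =
      (toPolynomial h (f 2)).comp param := by
    refine algHom_ext fun i => ?_
    rcases i with i | i
    · simp [reesMap, param, toPolynomial]
    · simp only [AlgHom.comp_apply, reesMap, param, aeval_X, Sum.elim_inr]
      fin_cases i
      · simp [toPolynomial, h0, ← Polynomial.C_mul_X_eq_monomial, mul_assoc]
      · simp [toPolynomial, h1, ← Polynomial.C_mul_X_eq_monomial, mul_assoc]
      · simp [toPolynomial, ← Polynomial.C_mul_X_eq_monomial]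
  exact congr($this a)

lemma mem_reesIdeal_iff {f : Fin 3 → PolyR K} {h : PolyR K} (h0 : f 0 = X 1 * h)
    (h1 : f 1 = X 0 * h) (a : PolyA K) :
    a ∈ reesIdeal f ↔ toPolynomial h (f 2) (param a) = 0 := by
  rw [reesIdeal, RingHom.mem_ker, ← coe_reesMap h0 h1]
  exact (ZeroMemClass.coe_eq_zero).symm

/-- The inclusion of `K[x₀, x₁, x₂, z]` in `K[x₀, x₁, x₂, z, w]`. -/
noncomputable def inclZ : MvPolynomial (Fin 3 ⊕ Unit) K →ₐ[K] PolyP K :=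
  rename (Sum.map id fun _ => 0)

/-- Since `z ↦ ht`, the substitution `t ↦ z/h` is a left inverse over the fraction field. -/
lemma toPolynomial_inclZ_injective {h : PolyR K} (hh : h ≠ 0) (g : PolyR K) :
    Function.Injective ((toPolynomial h g).comp inclZ) := by
  let C := MvPolynomial (Fin 3 ⊕ Unit) K
  let L := FractionRing C
  let j : PolyR K →ₐ[K] L := (IsScalarTower.toAlgHom K C L).comp (rename Sum.inl)
  have hj : j h ≠ 0 := by
    have hinj : Function.Injective j :=
      (IsFractionRing.injective C L).comp (rename_injective _ Sum.inl_injective)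
    exact fun h' => hh (hinj (by rw [h', map_zero]))
  let ψ : Polynomial (PolyR K) →ₐ[K] L :=
    Polynomial.eval₂AlgHom j (algebraMap C L (X (Sum.inr ())) / j h) fun _ => Commute.all _ _
  have hψC : ∀ r, ψ (Polynomial.C r) = j r := fun r => by simp [ψ]
  have hψX : ψ Polynomial.X = algebraMap C L (X (Sum.inr ())) / j h := by simp [ψ]
  have hψ : ψ.comp ((toPolynomial h g).comp inclZ) = IsScalarTower.toAlgHom K C L := by
    refine algHom_ext fun i => ?_
    rcases i with i | i
    · simp [inclZ, toPolynomial, hψC, j, C]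
    · simp only [AlgHom.comp_apply, inclZ, rename_X, toPolynomial, aeval_X, Sum.map_inr,
        Sum.elim_inr, Matrix.cons_val_zero, map_mul, hψC, hψX]
      rw [mul_div_left_comm, div_self hj, mul_one]
      rfl
  refine Function.Injective.of_comp (f := ψ) ?_
  have : Function.Injective (ψ.comp ((toPolynomial h g).comp inclZ)) := by
    rw [hψ]
    exact IsFractionRing.injective C L
  exact this

lemma irreducible_param_symEquation_one {p : Fin 3 → PolyR K} (hp : p 2 ≠ 0)
    (hrel : IsRelPrime (p 2) (X 1 * p 0 + X 0 * p 1)) :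
    Irreducible (param (symEquation (presMatrix p) 1)) := by
  classical
  have hvars : ∀ (i : Fin 2) (r : PolyR K),
      Sum.inr i ∉ (rename (Sum.inl : Fin 3 → Fin 3 ⊕ Fin 2) r).vars := fun i r hi => by
    obtain ⟨j, -, hj⟩ := Finset.mem_image.1 (vars_rename _ _ hi)
    cases hj
  rw [param_symEquation_one]
  refine irreducible_mul_X_add _ _ _ ?_ (hvars 1 _) ?_ ?_
  · exact fun h => hp (rename_injective _ Sum.inl_injective (by simpa using h))
  · intro h
    rcases Finset.mem_union.1 (vars_mul _ _ h) with h | h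
    · simp at h
    · exact hvars 1 _ h
  · refine IsRelPrime.mul_right ?_ (isRelPrime_rename Sum.inl_injective hrel hp)
    refine (X_isRelPrime_iff.2 ?_).symm
    rintro ⟨D, hD⟩
    -- Setting `z = w = 0` fixes `p₂` and kills every multiple of `z`.
    have := congr(aeval (Sum.elim X 0 : Fin 3 ⊕ Fin 2 → PolyR K) $hD)
    rw [aeval_rename] at this
    exact hp (by simpa [Function.comp_def, aeval_X_left] using this)

lemma toPolynomial_param_symEquation_one {p : Fin 3 → PolyR K} {h g : PolyR K}
    (hrel : p 2 * g + h * (X 1 * p 0 + X 0 * p 1) = 0) :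
    toPolynomial h g (param (symEquation (presMatrix p) 1)) = 0 := by
  have hw : toPolynomial h g (X (Sum.inr 1)) = Polynomial.C g * Polynomial.X := by
    simp [toPolynomial]
  have hz : toPolynomial h g (X (Sum.inr 0)) = Polynomial.C h * Polynomial.X := by
    simp [toPolynomial]
  rw [param_symEquation_one, map_add, map_mul, map_mul, toPolynomial_rename,
    toPolynomial_rename, hw, hz]
  have := congr(Polynomial.C $hrel)
  rw [map_add, map_mul, map_mul, map_zero] at this
  linear_combination Polynomial.X * this

/-- The kernel of `toPolynomial` is generated by the image of the second equation of the
symmetric algebra. -/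
lemma param_symEquation_one_dvd {p : Fin 3 → PolyR K} {h g : PolyR K} (hh : h ≠ 0)
    (hp : p 2 ≠ 0) (hcop : IsRelPrime (p 2) (X 1 * p 0 + X 0 * p 1))
    (hrel : p 2 * g + h * (X 1 * p 0 + X 0 * p 1) = 0) {a : PolyP K}
    (ha : toPolynomial h g a = 0) : param (symEquation (presMatrix p) 1) ∣ a := by
  have e0 : inclZ (rename Sum.inl (p 2)) = rename Sum.inl (p 2) := by
    rw [inclZ, rename_rename]
    rfl
  have e1 : inclZ (X (Sum.inr ()) * rename Sum.inl (X 1 * p 0 + X 0 * p 1)) =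
      X (Sum.inr 0) * rename Sum.inl (X 1 * p 0 + X 0 * p 1) := by
    rw [inclZ, map_mul, rename_X, rename_rename]
    rfl
  have key := dvd_of_map_eq_zero (toPolynomial h g) inclZ (toPolynomial_inclZ_injective hh g)
    (Sum.inr 1) (rename Sum.inl (p 2))
    (X (Sum.inr ()) * rename Sum.inl (X 1 * p 0 + X 0 * p 1))
    (fun h => hp (rename_injective _ Sum.inl_injective (by simpa using h)))
  rw [e0, e1, ← param_symEquation_one] at key
  refine key (irreducible_param_symEquation_one hp hcop).prime
    (toPolynomial_param_symEquation_one hrel) ?_ ha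
  rintro (j | j) hj
  · exact ⟨X (Sum.inl j), by simp [inclZ]⟩
  · fin_cases j
    · exact ⟨X (Sum.inr ()), by simp [inclZ]⟩
    · exact absurd rfl hj

lemma presMatrix_mulVecLin (p : Fin 3 → PolyR K) (v : Fin 2 → PolyR K) :
    (presMatrix p).mulVecLin v =
      ![X 0 * v 0 + p 0 * v 1, -(X 1 * v 0) + p 1 * v 1, p 2 * v 1] := by
  ext i : 1
  fin_cases i <;> simp [presMatrix, Matrix.mulVec, dotProduct, Fin.sum_univ_two]

lemma generatorsMap_apply (f v : Fin 3 → PolyR K) :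
    generatorsMap f v = v 0 * f 0 + v 1 * f 1 + v 2 * f 2 := by
  simp [generatorsMap, Fintype.linearCombination_apply, Fin.sum_univ_three]

lemma not_X_dvd_X {i j : Fin 3} (h : i ≠ j) : ¬ (X i : PolyR K) ∣ X j := by
  rw [X_dvd_X]
  simpa using h

/-- What the presentation says about `f` and `p`. -/
lemma IsPresentation.exists_factor {f p : Fin 3 → PolyR K} (hp : ∀ i, constantCoeff (p i) = 0)
    (hpres : IsPresentation (presMatrix p) f) : ∃ h : PolyR K, h ≠ 0 ∧ f 0 = X 1 * h ∧
      f 1 = X 0 * h ∧ p 2 * f 2 + h * (X 1 * p 0 + X 0 * p 1) = 0 ∧ p 2 ≠ 0 ∧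
      IsRelPrime (p 2) (X 1 * p 0 + X 0 * p 1) := by
  have hrange : ∀ v : Fin 2 → PolyR K,
      (X 0 * v 0 + p 0 * v 1) * f 0 + (-(X 1 * v 0) + p 1 * v 1) * f 1 + p 2 * v 1 * f 2 = 0 :=
    fun v => by
      have := hpres.exact.apply_apply_eq_zero v
      rwa [presMatrix_mulVecLin, generatorsMap_apply] at this
  have hsyz : ∀ a b c : PolyR K, a * f 0 + b * f 1 + c * f 2 = 0 → ∃ s t,
      X 0 * s + p 0 * t = a ∧ -(X 1 * s) + p 1 * t = b ∧ p 2 * t = c := fun a b c h => by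
    obtain ⟨v, hv⟩ := (hpres.exact ![a, b, c]).1 (by rw [generatorsMap_apply]; exact h)
    rw [presMatrix_mulVecLin] at hv
    exact ⟨v 0, v 1, by simpa using congr($hv 0), by simpa using congr($hv 1),
      by simpa using congr($hv 2)⟩
  have h01 : X 0 * f 0 = X 1 * f 1 := by
    have := hrange ![1, 0]
    simp only [Matrix.cons_val_zero, Matrix.cons_val_one] at this
    linear_combination this
  obtain ⟨h, h0⟩ : X 1 ∣ f 0 :=
    (X_prime.dvd_or_dvd ⟨f 1, h01⟩).resolve_left (not_X_dvd_X (by decide))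
  have h1 : f 1 = X 0 * h := by
    refine mul_left_cancel₀ (X_ne_zero (1 : Fin 3)) ?_
    rw [← h01, h0]
    ring
  have hrel : p 2 * f 2 + h * (X 1 * p 0 + X 0 * p 1) = 0 := by
    have := hrange ![0, 1]
    simp only [Matrix.cons_val_zero, Matrix.cons_val_one] at this
    rw [h0, h1] at this
    linear_combination this
  have hh : h ≠ 0 := by
    rintro rfl
    -- If `f₀ = 0`, then `(1, 0, 0)` is a syzygy, but all entries of the first row of the matrix
    -- have zero constant term.
    obtain ⟨s, t, hst, -⟩ := hsyz 1 0 0 (by rw [h0]; ring)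
    have := congr(constantCoeff $hst)
    simp [hp] at this
  have hp2 : p 2 ≠ 0 := by
    intro h2
    have hq : X 1 * p 0 + X 0 * p 1 = 0 := by
      rw [h2, zero_mul, zero_add] at hrel
      exact (mul_eq_zero.1 hrel).resolve_left hh
    -- With `p₂ = 0` the two columns are proportional, against injectivity.
    have : (![p 0, -X 0] : Fin 2 → PolyR K) = 0 := by
      refine hpres.injective ?_
      rw [map_zero, presMatrix_mulVecLin]
      ext i : 1
      fin_cases i
      · simp
        ring
      · simp
        linear_combination -hq
      · simp [h2]
    exact X_ne_zero (R := K) (0 : Fin 3) (by simpa using congr($this 1))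
  refine ⟨h, hh, h0, h1, hrel, hp2, ?_⟩
  rintro e ⟨p', hp'⟩ ⟨q', hq'⟩
  have he : e ≠ 0 := fun h => hp2 (by rw [hp', h, zero_mul])
  have hne : p' ≠ 0 := fun h => hp2 (by rw [hp', h, mul_zero])
  have hrel' : p' * f 2 + h * q' = 0 := by
    refine mul_left_cancel₀ he ?_
    rw [hp', hq'] at hrel
    linear_combination hrel
  -- Dividing the second column by `e` gives syzygies with last entry `x₁p'` or `x₀p'`. Such an
  -- entry is a multiple of `p₂ = e p'`, so `e` divides both `x₁` and `x₀`.
  have hd1 : e ∣ X 1 := by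
    obtain ⟨s, t, -, -, h3⟩ := hsyz q' 0 (X 1 * p') (by
      rw [h0]
      linear_combination X 1 * hrel')
    refine ⟨t, mul_left_cancel₀ hne ?_⟩
    rw [hp'] at h3
    linear_combination -h3
  have hd0 : e ∣ X 0 := by
    obtain ⟨s, t, -, -, h3⟩ := hsyz 0 q' (X 0 * p') (by
      rw [h1]
      linear_combination X 0 * hrel')
    refine ⟨t, mul_left_cancel₀ hne ?_⟩
    rw [hp'] at h3
    linear_combination -h3
  exact (X_isRelPrime_iff.2 (not_X_dvd_X (K := K) (show (0 : Fin 3) ≠ 1 by decide))) hd0 hd1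

end

/-! ### Sylvester forms: bidegrees, generation and minimality -/

section

variable {K : Type*} [Field K]

/-- The evaluation `x₀, y₀ ↦ t` that sends the other variables to zero. -/
noncomputable def diagEval : PolyA K →ₐ[K] Polynomial K :=
  aeval (Sum.elim ![Polynomial.X, 0, 0] ![Polynomial.X, 0, 0])

lemma coeff_zero_diagEval (a : PolyA K) : (diagEval a).coeff 0 = constantCoeff a := by
  induction a using MvPolynomial.induction_on with
  | C r => simp [diagEval]
  | add a b ha hb => simp [ha, hb]
  | mul_X a i ha =>
    rw [map_mul, Polynomial.mul_coeff_zero, map_mul, constantCoeff_X, mul_zero]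
    rcases i with i | i <;> fin_cases i <;> simp [diagEval]

lemma X_dvd_diagEval {a : PolyA K} : Polynomial.X ∣ diagEval a ↔ constantCoeff a = 0 := by
  rw [Polynomial.X_dvd_iff, coeff_zero_diagEval]

lemma constantCoeff_eq_zero_of_isWeightedHomogeneous {σ M : Type*} [AddCommMonoid M]
    {w : σ → M} {n : M} {F : MvPolynomial σ K} (hF : IsWeightedHomogeneous w F n) (hn : n ≠ 0) :
    constantCoeff F = 0 := by
  by_contra h
  exact hn (by simpa using (hF (d := 0) h).symm)

lemma constantCoeff_y (j : Fin 3) : constantCoeff (y j : PolyA K) = 0 := constantCoeff_X _ _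

lemma isBihomogeneous_x (i : Fin 3) : IsBihomogeneous (x i : PolyA K) (1, 0) :=
  isWeightedHomogeneous_X K bidegWeight (Sum.inl i)

lemma isBihomogeneous_y (i : Fin 3) : IsBihomogeneous (y i : PolyA K) (0, 1) :=
  isWeightedHomogeneous_X K bidegWeight (Sum.inr i)

lemma isBihomogeneous_inclR {r : PolyR K} {n : ℕ} (hr : r.IsHomogeneous n) :
    IsBihomogeneous (inclR r) (n, 0) := by
  refine isWeightedHomogeneous_rename fun u hu => ?_
  have := hr hu
  rw [Finsupp.weight_apply, Finsupp.sum_fintype _ _ (by simp)] at this ⊢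
  simp only [Function.comp_apply, bidegWeight, Sum.elim_inl, Pi.one_apply, smul_eq_mul,
    mul_one] at this ⊢
  ext <;> simp [← this, Fin.sum_univ_three]

lemma weightedHomogeneousComponent_mul_X {σ M : Type*} [AddCancelCommMonoid M] {w : σ → M}
    (e : M) (a : MvPolynomial σ K) (i : σ) :
    weightedHomogeneousComponent w (e + w i) (a * X i) =
      weightedHomogeneousComponent w e a * X i := by
  classical
  ext u
  simp only [coeff_weightedHomogeneousComponent, coeff_mul_X']
  by_cases hi : i ∈ u.support
  · have hu : u - Finsupp.single i 1 + Finsupp.single i 1 = u :=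
      tsub_add_cancel_of_le (by simpa [Nat.one_le_iff_ne_zero] using hi)
    have hw : Finsupp.weight w u = Finsupp.weight w (u - Finsupp.single i 1) + w i := by
      conv_lhs => rw [← hu, map_add, Finsupp.weight_single, one_smul]
    simp only [if_pos hi, hw, add_left_inj]
  · simp only [if_neg hi, ite_self]

/-- A nonzero bihomogeneous element of `(x₀, x₁)` is a bihomogeneous combination of `x₀, x₁`. -/
lemma exists_bihomogeneous_eq {k l : ℕ} {F : PolyA K} (hF : IsBihomogeneous F (k, l))
    (hF0 : F ≠ 0) (hmem : F ∈ Ideal.span {(x 0 : PolyA K), x 1}) :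
    ∃ k' a b, k = k' + 1 ∧ IsBihomogeneous a (k', l) ∧ IsBihomogeneous b (k', l) ∧
      F = a * x 0 + b * x 1 := by
  classical
  have hk : k ≠ 0 := by
    rintro rfl
    have hset : ({(x 0 : PolyA K), x 1} : Set (PolyA K)) =
        X '' {Sum.inl (0 : Fin 3), (Sum.inl 1 : Fin 3 ⊕ Fin 3)} := by
      simp [Set.image_pair, x]
    rw [hset, mem_ideal_span_X_image] at hmem
    obtain ⟨u, hu⟩ := exists_coeff_ne_zero hF0
    obtain ⟨i, hi, hui⟩ := hmem u (mem_support_iff.2 hu)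
    have hw := congr($(hF hu).1)
    rw [Finsupp.weight_apply, Finsupp.sum_fintype _ _ (by simp)] at hw
    simp [bidegWeight, Fin.sum_univ_three] at hw
    rcases hi with rfl | rfl
    · exact hui hw.1.1
    · exact hui hw.1.2
  obtain ⟨k', rfl⟩ := Nat.exists_eq_succ_of_ne_zero hk
  obtain ⟨a, b, hab⟩ := Ideal.mem_span_pair.1 hmem
  refine ⟨k', weightedHomogeneousComponent bidegWeight (k', l) a,
    weightedHomogeneousComponent bidegWeight (k', l) b, rfl,
    weightedHomogeneousComponent_isWeightedHomogeneous _ _,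
    weightedHomogeneousComponent_isWeightedHomogeneous _ _, ?_⟩
  have h0 := weightedHomogeneousComponent_mul_X (w := bidegWeight) (k', l) a (Sum.inl 0)
  have h1 := weightedHomogeneousComponent_mul_X (w := bidegWeight) (k', l) b (Sum.inl 1)
  have hsum : ∀ i : Fin 3, (k', l) + bidegWeight (Sum.inl i) = (k' + 1, l) := fun i => by
    simp [bidegWeight]
  rw [hsum] at h0 h1
  rw [x, x, ← h0, ← h1, ← map_add]
  change F = weightedHomogeneousComponent bidegWeight (k' + 1, l) (a * x 0 + b * x 1)
  rw [hab]
  exact (IsWeightedHomogeneous.weightedHomogeneousComponent_same hF).symm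

/-- The properties of the `i`-th Sylvester form. -/
structure IsStage (p : Fin 3 → PolyR K) (d i : ℕ) (F : PolyA K) : Prop where
  le : i + 1 ≤ d
  isBihomogeneous : IsBihomogeneous F (d - 1 - i, i + 1)
  param_eq : param F = X (Sum.inr 0) ^ i * param (symEquation (presMatrix p) 1)
  sq_dvd : Polynomial.X ^ 2 ∣ diagEval F

lemma isStage_zero {p : Fin 3 → PolyR K} {d : ℕ} (hd : 2 ≤ d)
    (hp : ∀ i, (p i).IsHomogeneous (d - 1)) :
    IsStage p d 0 (symEquation (presMatrix p) 1) where
  le := by omega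
  isBihomogeneous := by
    have h : ∀ i, IsBihomogeneous (y i * inclR (p i)) (d - 1 - 0, 0 + 1) := fun i => by
      have := (isBihomogeneous_y i).mul (isBihomogeneous_inclR (hp i))
      simpa [IsBihomogeneous] using this
    rw [symEquation_presMatrix_one]
    exact ((h 0).add (h 1)).add (h 2)
  param_eq := by rw [pow_zero, one_mul]
  sq_dvd := by
    have h : ∀ i, Polynomial.X ^ 2 ∣ diagEval (y i * inclR (p i)) := fun i => by
      rw [map_mul, sq]
      refine mul_dvd_mul (X_dvd_diagEval.2 (constantCoeff_y i)) (X_dvd_diagEval.2 ?_)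
      refine constantCoeff_eq_zero_of_isWeightedHomogeneous (isBihomogeneous_inclR (hp i)) ?_
      simp only [ne_eq, Prod.mk_eq_zero, not_and]
      omega
    rw [symEquation_presMatrix_one, map_add, map_add]
    exact dvd_add (dvd_add (h 0) (h 1)) (h 2)

section Stage

variable {p : Fin 3 → PolyR K} {d : ℕ}

lemma IsStage.ne_zero {i : ℕ} {F : PolyA K} (hG : param (symEquation (presMatrix p) 1) ≠ 0)
    (hF : IsStage p d i F) : F ≠ 0 := by
  rintro rfl
  have := hF.param_eq
  rw [map_zero] at this
  exact mul_ne_zero (pow_ne_zero _ (X_ne_zero _)) hG this.symm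

lemma IsStage.succ {i : ℕ} {F F' : PolyA K} (hG : param (symEquation (presMatrix p) 1) ≠ 0)
    (hF : IsStage p d i F) (hstep : IsSylvesterStep F F') : IsStage p d (i + 1) F' := by
  obtain ⟨⟨k, l⟩, a, b, ha, hb, hab, rfl⟩ := hstep
  have hdet : Matrix.det !![y 0, -y 1; a, b] = y 0 * b + y 1 * a := by
    rw [Matrix.det_fin_two_of]
    ring
  -- A nonzero form has only one bidegree. The `+ 1` shows that `d - 1 - i` is positive, which gives
  -- the bound for the next stage.
  have hdeg : (d - 1 - i, i + 1) = (k + 1, l) := by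
    refine hF.isBihomogeneous.inj_right (hF.ne_zero hG) ?_
    rw [hab]
    exact (ha.mul (isBihomogeneous_x 0)).add (hb.mul (isBihomogeneous_x 1))
  obtain ⟨hk, rfl⟩ := Prod.mk.inj hdeg
  have hle := hF.le
  rw [hdet]
  refine ⟨by omega, ?_, ?_, ?_⟩
  · have h : ∀ j (c : PolyA K), IsBihomogeneous c (k, i + 1) →
        IsBihomogeneous (y j * c) (d - 1 - (i + 1), i + 1 + 1) := fun j c hc => by
      have hsum : (d - 1 - (i + 1), i + 1 + 1) = (0, 1) + (k, i + 1) :=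
        Prod.ext (show d - 1 - (i + 1) = 0 + k by omega)
          (show i + 1 + 1 = 1 + (i + 1) by omega)
      rw [hsum]
      exact IsWeightedHomogeneous.mul (isBihomogeneous_y j) hc
    exact (h 0 b hb).add (h 1 a ha)
  · have := hF.param_eq
    rw [hab] at this
    -- The determinant `y₀b + y₁a` maps to `z(x₁b + x₀a)`, that is, to `z` times the image of `F`.
    simp only [map_add, map_mul, param_x, param_y_zero, param_y_one] at this ⊢
    rw [pow_succ]
    linear_combination X (Sum.inr 0) * this
  · have h : ∀ j (c : PolyA K), IsBihomogeneous c (k, i + 1) →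
        Polynomial.X ^ 2 ∣ diagEval (y j * c) := fun j c hc => by
      rw [map_mul, sq]
      exact mul_dvd_mul (X_dvd_diagEval.2 (constantCoeff_y j))
        (X_dvd_diagEval.2 (constantCoeff_eq_zero_of_isWeightedHomogeneous hc (by simp)))
    rw [map_add]
    exact dvd_add (h 0 b hb) (h 1 a ha)

lemma IsStage.exists_run (hG : param (symEquation (presMatrix p) 1) ≠ 0) {i : ℕ} {F : PolyA K}
    (hF : IsStage p d i F) : ∃ m F', IsSylvesterRun F m F' := by
  induction h : d - i generalizing i F with
  | zero => have := hF.le; omega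
  | succ n ih =>
    by_cases hmem : F ∈ Ideal.span {(x 0 : PolyA K), x 1}
    · obtain ⟨k, a, b, -, ha, hb, hab⟩ :=
        exists_bihomogeneous_eq hF.isBihomogeneous (hF.ne_zero hG) hmem
      have hstep : IsSylvesterStep F (Matrix.det !![y 0, -y 1; a, b]) :=
        ⟨_, a, b, ha, hb, hab, rfl⟩
      obtain ⟨m, F', hrun⟩ := ih (hF.succ hG hstep) (by omega)
      refine ⟨m + 1, Fin.cons F F', rfl, fun j => ?_, ?_⟩
      · refine Fin.cases ?_ (fun j => ?_) j
        · simpa [hrun.start] using hstep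
        · simpa [← Fin.succ_castSucc] using hrun.step j
      · rw [← Fin.succ_last, Fin.cons_succ]
        exact hrun.halts
    · exact ⟨0, fun _ => F, rfl, fun j => j.elim0, hmem⟩

lemma IsSylvesterRun.isStage {m : ℕ} {F : Fin (m + 1) → PolyA K}
    (hG : param (symEquation (presMatrix p) 1) ≠ 0)
    (h0 : IsStage p d 0 (symEquation (presMatrix p) 1))
    (hrun : IsSylvesterRun (symEquation (presMatrix p) 1) m F) (i : Fin (m + 1)) :
    IsStage p d i (F i) := by
  induction i using Fin.induction with
  | zero => rw [hrun.start]; exact h0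
  | succ i ih => exact ih.succ hG (hrun.step i)

/-- The last Sylvester form bounds the order of the second equation. -/
lemma IsSylvesterRun.exists_weight_le {m : ℕ} {F : Fin (m + 1) → PolyA K}
    (hstage : ∀ i : Fin (m + 1), IsStage p d i (F i))
    (hrun : IsSylvesterRun (symEquation (presMatrix p) 1) m F) :
    ∃ u, coeff u (param (symEquation (presMatrix p) 1)) ≠ 0 ∧
      Finsupp.weight paramWeight u ≤ m := by
  by_contra! hcon
  refine hrun.halts (mem_span_of_weightGE_one p ?_)
  -- The factor `zᵐ` has weight `-m`, so weights at least `m + 1` in `G` leave weight at least 1 in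
  -- `param Fₘ`.
  rw [(hstage _).param_eq, Fin.val_last, show (1 : ℤ) = m • (-1) + (m + 1) by simp]
  refine WeightGE.mul ?_ fun u hu => hcon u hu
  exact .of_isWeightedHomogeneous ((isWeightedHomogeneous_X K paramWeight (Sum.inr 0)).pow m)
    le_rfl

lemma IsSylvesterRun.mem_span {m : ℕ} {F : Fin (m + 1) → PolyA K}
    (hstage : ∀ i : Fin (m + 1), IsStage p d i (F i))
    (hrun : IsSylvesterRun (symEquation (presMatrix p) 1) m F) {a : PolyA K}
    (ha : param (symEquation (presMatrix p) 1) ∣ param a) :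
    a ∈ Ideal.span (Set.range
      (Fin.cons (symEquation (presMatrix p) 0) F : Fin (m + 2) → PolyA K)) := by
  set I := Ideal.span (Set.range
    (Fin.cons (symEquation (presMatrix p) 0) F : Fin (m + 2) → PolyA K))
  have hFI : ∀ i, F i ∈ I := fun i => Ideal.subset_span ⟨i.succ, Fin.cons_succ _ _ _⟩
  have hgI : symEquation (presMatrix p) 0 ∈ I := Ideal.subset_span ⟨0, rfl⟩
  obtain ⟨D, hD⟩ := ha
  have hDw : WeightGE paramWeight (0 - m) D :=
    WeightGE.of_mul (hD ▸ weightGE_param a) (hrun.exists_weight_le hstage)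
  obtain ⟨b, hb, hbD⟩ := hDw.mem_submodule
    (((I.restrictScalars K).map param.toLinearMap).comap
      (LinearMap.mulLeft K (param (symEquation (presMatrix p) 1)))) fun u r hu => by
    obtain ⟨i, hi, c, hc⟩ := exists_pow_mul_param_eq_monomial m u r (by omega)
    refine ⟨c * F ⟨i, by omega⟩, I.mul_mem_left _ (hFI _), ?_⟩
    rw [AlgHom.toLinearMap_apply, map_mul, (hstage _).param_eq, LinearMap.mulLeft_apply, ← hc]
    ring
  obtain ⟨E, hE⟩ := dvd_of_param_eq_zero p (a := a - b) (by
    rw [map_sub, sub_eq_zero, hD]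
    exact hbD.symm)
  rw [sub_eq_iff_eq_add.1 hE]
  exact I.add_mem (I.mul_mem_right _ hgI) hb

/-- The coefficients of a relation between the generators have no constant term. -/
lemma constantCoeff_eq_zero_of_relation {m : ℕ} {F : Fin (m + 1) → PolyA K}
    (hG : param (symEquation (presMatrix p) 1) ≠ 0)
    (hstage : ∀ i : Fin (m + 1), IsStage p d i (F i)) {c : Fin (m + 2) → PolyA K}
    (hc : ∑ j, c j * (Fin.cons (symEquation (presMatrix p) 0) F : Fin (m + 2) → PolyA K) j = 0)
    (j : Fin (m + 2)) : constantCoeff (c j) = 0 := by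
  rw [Fin.sum_univ_succ] at hc
  simp only [Fin.cons_zero, Fin.cons_succ] at hc
  have hF : ∀ i : Fin (m + 1), constantCoeff (c i.succ) = 0 := by
    let ev : PolyP K →ₐ[K] Polynomial K := aeval (Sum.elim 0 ![Polynomial.X, 0])
    have hev : ∀ a : PolyA K, ev (param a) = Polynomial.C (constantCoeff a) := fun a => by
      have : ev.comp param = (Algebra.ofId K (Polynomial K)).comp (aeval 0) := by
        refine algHom_ext fun i => ?_
        rcases i with i | i
        · simp [param, ev]
        · fin_cases i <;> simp [param, ev]
      have h := congr($this a)
      simpa [Algebra.ofId_apply, ← Polynomial.C_eq_algebraMap, aeval_zero] using h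
    have h1 := congr(param $hc)
    rw [map_add, map_mul, param_symEquation_zero, mul_zero, zero_add, map_zero, map_sum] at h1
    have h2 : ∑ i : Fin (m + 1), param (c i.succ) * X (Sum.inr 0) ^ (i : ℕ) = 0 := by
      refine mul_right_cancel₀ hG ?_
      rw [zero_mul, Finset.sum_mul, ← h1]
      refine Finset.sum_congr rfl fun i _ => ?_
      rw [map_mul, (hstage i).param_eq, mul_assoc]
    have h3 := congr(ev $h2)
    have hz : ev (X (Sum.inr 0)) = Polynomial.X := by simp [ev]
    simp only [map_sum, map_mul, map_pow, hev, hz, map_zero] at h3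
    intro i
    have h4 := congr(Polynomial.coeff $h3 i)
    simpa [Polynomial.finsetSum_coeff, Polynomial.coeff_X_pow, Fin.val_inj] using h4
  refine Fin.cases ?_ hF j
  have h1 := congr(diagEval $hc)
  rw [map_add, map_mul, map_zero, map_sum] at h1
  have hg : diagEval (symEquation (presMatrix p) 0) = Polynomial.X ^ 2 := by
    rw [symEquation_presMatrix_zero]
    simp [diagEval, x, y, sq]
  have h2 : Polynomial.X ^ 3 ∣
      ∑ i : Fin (m + 1), diagEval (c i.succ * F i) := Finset.dvd_sum fun i _ => by
    -- One factor of `t` comes from the coefficient, which has no constant term, and two come from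
    -- `Fᵢ`; `g₁` itself maps exactly to `t²`.
    rw [map_mul, pow_succ']
    exact mul_dvd_mul (X_dvd_diagEval.2 (hF i)) (hstage i).sq_dvd
  have h3 : Polynomial.X ^ 3 ∣ diagEval (c 0) * Polynomial.X ^ 2 := by
    rw [← hg, eq_neg_of_add_eq_zero_left h1]
    exact (dvd_neg).2 h2
  rw [pow_succ'] at h3
  exact X_dvd_diagEval.1 ((mul_dvd_mul_iff_right (pow_ne_zero 2 Polynomial.X_ne_zero)).1 h3)

/-- A redundant generator would give a relation in which its own coefficient is `-1`. -/
lemma notMem_span_of_relation {ι : Type*} [Fintype ι] {G : ι → PolyA K}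
    (h : ∀ c : ι → PolyA K, ∑ j, c j * G j = 0 → ∀ j, constantCoeff (c j) = 0) (i : ι) :
    G i ∉ Ideal.span (G '' {i}ᶜ) := by
  classical
  intro hi
  obtain ⟨l, hl, hli⟩ := (Finsupp.mem_span_image_iff_linearCombination _).1 hi
  have hl0 : l i = 0 := by
    by_contra h0
    exact (Finsupp.mem_supported _ _).1 hl (Finsupp.mem_support_iff.2 h0) rfl
  rw [Finsupp.linearCombination_apply, Finsupp.sum_fintype _ _ (by simp)] at hli
  have := h (fun j => l j - (Pi.single i 1 : ι → PolyA K) j) (by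
    simp only [sub_mul, Finset.sum_sub_distrib, Pi.single_apply, ite_mul, one_mul, zero_mul,
      Finset.sum_ite_eq', Finset.mem_univ, if_true]
    exact sub_eq_zero.2 hli) i
  simp [hl0] at this

end Stage

end

end PlaneRees

theorem mainTheorem11 {K : Type*} [Field K] (d : ℕ) (hd : 2 ≤ d)
    (f p : Fin 3 → PlaneRees.PolyR K)
    (hf : ∀ i, (f i).IsHomogeneous d)
    (hp : ∀ i, (p i).IsHomogeneous (d - 1))
    (hdim : ringKrullDim (PlaneRees.PolyR K ⧸ PlaneRees.idealOf f) = 1)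
    (hsat : PlaneRees.IsSaturated (PlaneRees.idealOf f))
    (hpres : PlaneRees.IsPresentation (PlaneRees.presMatrix p) f) :
    -- the iteration can be carried out until it stops, and it cannot go on forever
    (∃ (m : ℕ) (F : Fin (m + 1) → PlaneRees.PolyA K),
      PlaneRees.IsSylvesterRun (PlaneRees.symEquation (PlaneRees.presMatrix p) 1) m F) ∧
    (¬ ∃ F : ℕ → PlaneRees.PolyA K,
      F 0 = PlaneRees.symEquation (PlaneRees.presMatrix p) 1 ∧
        ∀ i, PlaneRees.IsSylvesterStep (F i) (F (i + 1))) ∧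
    -- the family `g₁, F₀ = g₂, F₁, …, Fₘ` generates the Rees ideal minimally
    ∀ (m : ℕ) (F : Fin (m + 1) → PlaneRees.PolyA K),
      PlaneRees.IsSylvesterRun (PlaneRees.symEquation (PlaneRees.presMatrix p) 1) m F →
        PlaneRees.IsMinimalGeneratingFamily (PlaneRees.reesIdeal f)
          (Fin.cons (PlaneRees.symEquation (PlaneRees.presMatrix p) 0) F :
            Fin (m + 2) → PlaneRees.PolyA K) ∧
        m + 1 ≤ d ∧
        PlaneRees.IsBihomogeneous
          (PlaneRees.symEquation (PlaneRees.presMatrix p) 0) (1, 1) ∧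
        ∀ i : Fin (m + 1),
          PlaneRees.IsBihomogeneous (F i) (d - 1 - (i : ℕ), (i : ℕ) + 1) := by
  have hp0 : ∀ i, MvPolynomial.constantCoeff (p i) = 0 := fun i =>
    PlaneRees.constantCoeff_eq_zero_of_isWeightedHomogeneous (hp i) (by omega)
  obtain ⟨h, hh, h0, h1, hrel, hp2, hcop⟩ := hpres.exists_factor hp0
  have hG := (PlaneRees.irreducible_param_symEquation_one hp2 hcop).ne_zero
  have hzero := PlaneRees.isStage_zero hd hp
  refine ⟨hzero.exists_run hG, ?_, fun m F hrun => ?_⟩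
  · rintro ⟨F, hF0, hstep⟩
    have hF : ∀ i, PlaneRees.IsStage p d i (F i) := fun i => by
      induction i with
      | zero => rwa [hF0]
      | succ i ih => exact ih.succ hG (hstep i)
    -- Stage `d` would require `d + 1 ≤ d`.
    have := (hF d).le
    omega
  have hstage := hrun.isStage hG hzero
  refine ⟨⟨le_antisymm ?_ ?_, ?_⟩, by simpa using (hstage (Fin.last m)).le, ?_,
    fun i => (hstage i).isBihomogeneous⟩
  · rw [Ideal.span_le]
    rintro _ ⟨j, rfl⟩
    rw [SetLike.mem_coe, PlaneRees.mem_reesIdeal_iff h0 h1]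
    refine Fin.cases ?_ (fun i => ?_) j
    · rw [Fin.cons_zero, PlaneRees.param_symEquation_zero, map_zero]
    · rw [Fin.cons_succ, (hstage i).param_eq, map_mul,
        PlaneRees.toPolynomial_param_symEquation_one hrel, mul_zero]
  · intro a ha
    rw [PlaneRees.mem_reesIdeal_iff h0 h1] at ha
    exact hrun.mem_span hstage (PlaneRees.param_symEquation_one_dvd hh hp2 hcop hrel ha)
  · exact PlaneRees.notMem_span_of_relation fun c hc =>
      PlaneRees.constantCoeff_eq_zero_of_relation hG hstage hc
  · rw [PlaneRees.symEquation_presMatrix_zero]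
    have hxy : ∀ i, PlaneRees.IsBihomogeneous (PlaneRees.x i * PlaneRees.y i : PlaneRees.PolyA K)
        (1, 1) := fun i =>
      (PlaneRees.isBihomogeneous_x i).mul (PlaneRees.isBihomogeneous_y i)
    exact (hxy 0).add (hxy 1).neg
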